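/- Let $\lambda\ge 1$. All spaces are real Banach spaces. A Banach space $X$ is called *$\lambda$-separably injective* if every bounded linear operator $t:W\to X$ defined on a closed subspace $W$ of a separable Banach space $Z$ extends to a bounded linear operator $T:Z\to X$ with $\|T\|\le\lambda\|t\|$. For $\varepsilon\ge 0$, a map $f:X\to Y$ between Banach spaces is a *standard $\varepsilon$-isometry* if $f(0)=0$ and $\bigl|\,\|f(x)-f(y)\|-\|x-y\|\,\bigr|\le\varepsilon$ for all $x,y\in X$; let $L(f)=\overline{\operatorname{span}}\,f(X)\subseteq Y$. For $\alpha,\gamma>0$, the pair $(X,Y)$ is *$(\alpha,\gamma)$-stable* if for every $\varepsilon\ge0$ and every standard $\varepsilon$-isometry $f:X\to Y$ there is a bounded linear operator $T:L(f)\to X$ with $\|T\|\le\alpha$ and $\|Tf(x)-x\|\le\gamma\varepsilon$ for all $x\in X$. Let $\{E_i\}_{i\in\Lambda}$ be a family of $\lambda$-separably injective Banach spaces, and let $X=\bigl(\sum_{i\in\Lambda}E_i\bigr)_{c_0}$ be the space of all families $(x_i)_{i\in\Lambda}$, $x_i\in E_i$, such that $\{i:\|x_i\|\ge\delta\}$ is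 finite for every $\delta>0$, with the norm $\sup_i\|x_i\|$. Then for every separable Banach space $Y$: 1. $(X,Y)$ is $(6\lambda^2,24\lambda^2)$-stable; 2. $(X,Y)$ is $(\alpha,\gamma)$-stable for all $\alpha>3\lambda(1+\lambda)$ and $\gamma>12\lambda(1+\lambda)$; 3. $(X,Y)$ is $(\alpha,\gamma)$-stable for all $\alpha>9\lambda^2$ and $\gamma>36\lambda^2$; 4. $(X,Y)$ is $(18(1+\lambda),72(1+\lambda))$-stable. -/

import Mathlib

open Filter Topology
open scoped ENNReal

universe u v

/-- The `c₀`-sum of a family of normed spaces: the subspace of the `ℓ∞`-sum (with the supremum norm)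
of those families `x` such that, for every `δ > 0`, `‖x i‖ < δ` for all but finitely many `i`. -/
def c0Sum {Λ : Type u} (E : Λ → Type v) [∀ i, NormedAddCommGroup (E i)]
    [∀ i, NormedSpace ℝ (E i)] : Submodule ℝ (lp E ∞) where
  carrier := {x | Tendsto (fun i => ‖x i‖) cofinite (𝓝 0)}
  zero_mem' := by
    simpa using (tendsto_const_nhds : Tendsto (fun _ : Λ => (0 : ℝ)) cofinite (𝓝 0))
  add_mem' := by
    intro x y hx hy
    have h : Tendsto (fun i => ‖x i‖ + ‖y i‖) cofinite (𝓝 0) := by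
      simpa using Tendsto.add hx hy
    exact squeeze_zero (fun i => norm_nonneg _) (fun i => norm_add_le (x i) (y i)) h
  smul_mem' := by
    intro c x hx
    have h : Tendsto (fun i => ‖c‖ * ‖x i‖) cofinite (𝓝 0) := by
      simpa using Tendsto.const_mul ‖c‖ hx
    exact h.congr fun i => (norm_smul c (x i)).symm

/-- The `c₀`-sum is closed in the `ℓ∞`-sum. -/
theorem isClosed_c0Sum {Λ : Type u} (E : Λ → Type v) [∀ i, NormedAddCommGroup (E i)]
    [∀ i, NormedSpace ℝ (E i)] : IsClosed (c0Sum E : Set (lp E ∞)) := by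
  rw [← closure_subset_iff_isClosed]
  intro x hx
  change Tendsto (fun i => ‖x i‖) cofinite (𝓝 0)
  rw [Metric.tendsto_nhds]
  intro δ hδ
  obtain ⟨y, hy, hxy⟩ := Metric.mem_closure_iff.1 hx (δ / 2) (half_pos hδ)
  have hy' : Tendsto (fun i => ‖y i‖) cofinite (𝓝 0) := hy
  filter_upwards [Metric.tendsto_nhds.1 hy' (δ / 2) (half_pos hδ)] with i hi
  rw [dist_zero_right, norm_norm] at hi ⊢
  have h1 : ‖x i - y i‖ ≤ ‖x - y‖ := lp.norm_apply_le_norm ENNReal.top_ne_zero (x - y) i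
  have h2 : ‖x i‖ ≤ ‖x i - y i‖ + ‖y i‖ := by
    simpa using norm_add_le (x i - y i) (y i)
  rw [dist_eq_norm] at hxy
  linarith

/-- The `c₀`-sum of a family of Banach spaces is a Banach space. -/
instance instCompleteSpaceC0Sum {Λ : Type u} (E : Λ → Type v) [∀ i, NormedAddCommGroup (E i)]
    [∀ i, NormedSpace ℝ (E i)] [∀ i, CompleteSpace (E i)] : CompleteSpace (c0Sum E) :=
  (isClosed_c0Sum E).completeSpace_coe

/-- `X` is `lam`-separably injective: every bounded linear operator `t` from a closed subspace of a
separable Banach space `Z` into `X` extends to a bounded linear operator on `Z` of norm at most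
`lam * ‖t‖`. (Every separable Banach space has an isometric copy in each universe.) -/
def IsSeparablyInjective (X : Type u) [NormedAddCommGroup X] [NormedSpace ℝ X] [CompleteSpace X]
    (lam : ℝ) : Prop :=
  ∀ (Z : Type u) [NormedAddCommGroup Z] [NormedSpace ℝ Z] [CompleteSpace Z]
    [TopologicalSpace.SeparableSpace Z] (W : Submodule ℝ Z), IsClosed (W : Set Z) →
    ∀ t : W →L[ℝ] X, ∃ T : Z →L[ℝ] X, (∀ w : W, T (w : Z) = t w) ∧ ‖T‖ ≤ lam * ‖t‖

/-- `f` is a standard `ε`-isometry: `f 0 = 0` and `f` changes distances by at most `ε`. -/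
def IsStandardEpsIsometry {X : Type u} {Y : Type v} [NormedAddCommGroup X]
    [NormedAddCommGroup Y] (ε : ℝ) (f : X → Y) : Prop :=
  f 0 = 0 ∧ ∀ x y : X, |‖f x - f y‖ - ‖x - y‖| ≤ ε

/-- `L(f)`, the closed linear span of the range of `f`. -/
def closedSpanRange {X : Type u} {Y : Type v} [NormedAddCommGroup Y] [NormedSpace ℝ Y]
    (f : X → Y) : Submodule ℝ Y :=
  (Submodule.span ℝ (Set.range f)).topologicalClosure

/-- The value `f x`, as an element of `L(f)`. -/
def toClosedSpanRange {X : Type u} {Y : Type v} [NormedAddCommGroup Y] [NormedSpace ℝ Y]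
    (f : X → Y) (x : X) : closedSpanRange f :=
  ⟨f x, Submodule.le_topologicalClosure _ (Submodule.subset_span (Set.mem_range_self x))⟩

/-- A map `f : X → Y` (in practice a standard `ε`-isometry) is `(α, γ)`-stable: there is a bounded
linear operator `T : L(f) → X` with `‖T‖ ≤ α` and `‖T (f x) - x‖ ≤ γ ε` for all `x`. -/
def IsStableMap {X : Type u} {Y : Type v} [NormedAddCommGroup X] [NormedSpace ℝ X]
    [NormedAddCommGroup Y] [NormedSpace ℝ Y] (α γ ε : ℝ) (f : X → Y) : Prop :=
  ∃ T : closedSpanRange f →L[ℝ] X, ‖T‖ ≤ α ∧ ∀ x : X, ‖T (toClosedSpanRange f x) - x‖ ≤ γ * ε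

/-- The pair `(X, Y)` of Banach spaces is `(α, γ)`-stable: `α, γ > 0`, and for every `ε ≥ 0` every
standard `ε`-isometry `f : X → Y` is `(α, γ)`-stable. -/
def IsStablePair (X : Type u) (Y : Type v) [NormedAddCommGroup X] [NormedSpace ℝ X]
    [CompleteSpace X] [NormedAddCommGroup Y] [NormedSpace ℝ Y] [CompleteSpace Y]
    (α γ : ℝ) : Prop :=
  0 < α ∧ 0 < γ ∧ ∀ ε : ℝ, 0 ≤ ε → ∀ f : X → Y, IsStandardEpsIsometry ε f → IsStableMap α γ ε f

/-! All four claims follow from one stronger bound: `f` is `(2λ, 8λ)`-stable. Two ingredients give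
it.

Comparison (`IsStandardEpsIsometry.norm_sum_le`): `‖∑ aₖ xₖ‖ ≤ ‖∑ aₖ f(xₖ)‖ + 3ε ∑ |aₖ|`. Choose
`dₖ` with `f(dₖ)` dense in the range of `f`. In `Y × ℓ¹`, with seminorm `‖y‖ + 3ε‖a‖₁`, the map `(∑
aₖ f(dₖ), a) ↦ ∑ aₖ dₖ` is then a contraction on a subspace. An extension `T` satisfies `T(f(dₖ), 0)
- dₖ = -T(0, eₖ)`, so the restriction of `T` to `Y` nearly inverts `f`.

Extension (`exists_extension_c0Sum`): the `c₀`-sum has the separable extension property with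
constant `2λ`. Coordinatewise extensions `Tᵢ` exist, but `Tᵢ z → 0` must be forced. With `yₖ → 0`
spanning a dense subspace, compactness yields `ηᵢ → 0` with `‖tᵢ v‖ ≤ 2p(jv + ∑ aₖ yₖ) + ηᵢ‖a‖₁`.
Adjoining an `ℓ¹` factor again gives extensions with `‖Tᵢ yₖ‖ ≤ ληᵢ`, hence `Tᵢ z → 0` on a dense
subspace and so everywhere. -/

/-! ### Finitely supported sequences with the `ℓ¹`-norm -/

/-- The `ℓ¹`-norm of a finitely supported sequence. -/
def l1Norm (a : ℕ →₀ ℝ) : ℝ := a.sum fun _ r => |r|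

theorem l1Norm_eq_sum {a : ℕ →₀ ℝ} {s : Finset ℕ} (h : a.support ⊆ s) :
    l1Norm a = ∑ k ∈ s, |a k| :=
  Finsupp.sum_of_support_subset a h _ (by simp)

theorem l1Norm_nonneg (a : ℕ →₀ ℝ) : 0 ≤ l1Norm a :=
  Finset.sum_nonneg fun _ _ => abs_nonneg _

theorem abs_apply_le_l1Norm (a : ℕ →₀ ℝ) (k : ℕ) : |a k| ≤ l1Norm a := by
  rw [l1Norm_eq_sum (s := insert k a.support) (Finset.subset_insert _ _)]
  exact Finset.single_le_sum (f := fun k => |a k|) (fun _ _ => abs_nonneg _)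
    (Finset.mem_insert_self _ _)

@[simp] theorem l1Norm_zero : l1Norm 0 = 0 := by simp [l1Norm]

@[simp] theorem l1Norm_single (k : ℕ) (r : ℝ) : l1Norm (Finsupp.single k r) = |r| := by
  simp [l1Norm]

theorem l1Norm_add_le (a b : ℕ →₀ ℝ) : l1Norm (a + b) ≤ l1Norm a + l1Norm b := by
  classical
  rw [l1Norm_eq_sum (a := a) (Finset.subset_union_left (s₂ := b.support)),
    l1Norm_eq_sum (a := b) (Finset.subset_union_right (s₁ := a.support)),
    l1Norm_eq_sum (a := a + b) Finsupp.support_add, ← Finset.sum_add_distrib]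
  exact Finset.sum_le_sum fun k _ => abs_add_le _ _

theorem l1Norm_smul (c : ℝ) (a : ℕ →₀ ℝ) : l1Norm (c • a) = |c| * l1Norm a := by
  rw [l1Norm_eq_sum (a := c • a) Finsupp.support_smul, l1Norm_eq_sum (a := a) subset_rfl,
    Finset.mul_sum]
  exact Finset.sum_congr rfl fun k _ => by simp [abs_mul]

theorem eq_zero_of_l1Norm_eq_zero {a : ℕ →₀ ℝ} (h : l1Norm a = 0) : a = 0 := by
  ext k
  simpa [h] using abs_apply_le_l1Norm a k

theorem exists_rat_l1Norm_sub_lt (a : ℕ →₀ ℝ) :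
    ∀ δ : ℝ, 0 < δ → ∃ b : ℕ →₀ ℚ,
      l1Norm (a - b.mapRange (fun q : ℚ => (q : ℝ)) (by simp)) < δ := by
  induction a using Finsupp.induction_linear with
  | zero => intro δ hδ; exact ⟨0, by simpa using hδ⟩
  | add a b ha hb =>
    intro δ hδ
    obtain ⟨a', ha'⟩ := ha (δ / 2) (half_pos hδ)
    obtain ⟨b', hb'⟩ := hb (δ / 2) (half_pos hδ)
    refine ⟨a' + b', ?_⟩
    rw [Finsupp.mapRange_add (by simp), add_sub_add_comm]
    linarith [l1Norm_add_le (a - a'.mapRange (fun q : ℚ => (q : ℝ)) (by simp))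
      (b - b'.mapRange (fun q : ℚ => (q : ℝ)) (by simp))]
  | single k r =>
    intro δ hδ
    obtain ⟨q, hq, hq'⟩ := exists_rat_btwn (lt_add_of_pos_right r hδ)
    refine ⟨Finsupp.single k q, ?_⟩
    rw [Finsupp.mapRange_single, ← Finsupp.single_sub, l1Norm_single, abs_lt]
    constructor <;> linarith

/-! ### Separable seminorms and embedding into `ℓ∞` -/

/-- A seminorm is separable if it admits a countable dense set. -/
def Seminorm.IsSeparable {Z : Type*} [AddCommGroup Z] [Module ℝ Z] (p : Seminorm ℝ Z) : Prop :=
  ∃ D : ℕ → Z, ∀ z, ∀ δ > 0, ∃ n, p (z - D n) < δ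

/-- The seminorm `p z + η ‖a‖₁` on pairs `(z, a)`. -/
noncomputable def Seminorm.prodL1 {Z : Type*} [AddCommGroup Z] [Module ℝ Z] (p : Seminorm ℝ Z) (η : ℝ)
    (hη : 0 ≤ η) :=
  Seminorm.of (𝕜 := ℝ) (E := Z × (ℕ →₀ ℝ)) (fun x => p x.1 + η * l1Norm x.2)
    (fun x y => by
      have h1 := map_add_le_add p x.1 y.1
      have h2 := mul_le_mul_of_nonneg_left (l1Norm_add_le x.2 y.2) hη
      simp only [Prod.fst_add, Prod.snd_add]
      linarith)
    (fun c x => by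
      simp only [Prod.smul_fst, Prod.smul_snd, map_smul_eq_mul, l1Norm_smul, Real.norm_eq_abs]
      ring)

theorem Seminorm.prodL1_apply {Z : Type*} [AddCommGroup Z] [Module ℝ Z] (p : Seminorm ℝ Z) (η : ℝ)
    (hη : 0 ≤ η) (x : Z × (ℕ →₀ ℝ)) : p.prodL1 η hη x = p x.1 + η * l1Norm x.2 := rfl

theorem Seminorm.IsSeparable.prodL1 {Z : Type*} [AddCommGroup Z] [Module ℝ Z] {p : Seminorm ℝ Z}
    (hp : p.IsSeparable) (η : ℝ) (hη : 0 ≤ η) : (p.prodL1 η hη).IsSeparable := by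
  obtain ⟨D, hD⟩ := hp
  obtain ⟨e, he⟩ := exists_surjective_nat (ℕ × (ℕ →₀ ℚ))
  refine ⟨fun n => (D (e n).1, (e n).2.mapRange (fun q : ℚ => (q : ℝ)) (by simp)), ?_⟩
  rintro ⟨z, a⟩ δ hδ
  obtain ⟨m, hm⟩ := hD z (δ / 2) (half_pos hδ)
  obtain ⟨b, hb⟩ := exists_rat_l1Norm_sub_lt a (δ / 2 / (η + 1)) (by positivity)
  obtain ⟨n, hn⟩ := he (m, b)
  refine ⟨n, ?_⟩
  simp only [hn, Seminorm.prodL1_apply, Prod.mk_sub_mk]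
  have h1 : (η + 1) * l1Norm (a - b.mapRange (fun q : ℚ => (q : ℝ)) (by simp)) < δ / 2 := by
    rwa [lt_div_iff₀ (by positivity), mul_comm] at hb
  linarith [l1Norm_nonneg (a - b.mapRange (fun q : ℚ => (q : ℝ)) (by simp))]

/-- For every seminorm `p` and point `z` there is a linear functional dominated by `p` norming `z`. -/
theorem Seminorm.exists_norming_functional {Z : Type*} [AddCommGroup Z] [Module ℝ Z]
    (p : Seminorm ℝ Z) (z : Z) : ∃ g : Z →ₗ[ℝ] ℝ, (∀ x, |g x| ≤ p x) ∧ g z = p z := by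
  let : SeminormedAddCommGroup Z := p.toAddGroupSeminorm.toSeminormedAddCommGroup
  let : NormedSpace ℝ Z := ⟨fun c x => (map_smul_eq_mul p c x).le⟩
  obtain ⟨g, hg, hgz⟩ := exists_dual_vector'' ℝ z
  refine ⟨g.toLinearMap, fun x => ?_, hgz⟩
  have := g.le_of_opNorm_le hg x
  rw [one_mul] at this
  exact this

/-- A space with a separable seminorm embeds isometrically into `ℓ∞`, in any universe. -/
theorem Seminorm.IsSeparable.exists_isometric_embedding {Z : Type*} [AddCommGroup Z] [Module ℝ Z]
    {p : Seminorm ℝ Z} (hp : p.IsSeparable) :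
    ∃ J : Z →ₗ[ℝ] lp (fun _ : ULift.{u} ℕ => ℝ) ∞, ∀ z, ‖J z‖ = p z := by
  obtain ⟨D, hD⟩ := hp
  -- Functionals norming only the dense points suffice: an approximation of `z` within `δ / 2` costs
  -- `δ / 2` in `p` and `δ / 2` in `g n`.
  choose g hg hgD using fun n => p.exists_norming_functional (D n)
  have hmem (z : Z) : Memℓp (fun n : ULift.{u} ℕ => g n.down z) ∞ :=
    memℓp_infty ⟨p z, by rintro _ ⟨n, rfl⟩; exact hg _ _⟩
  let J : Z →ₗ[ℝ] lp (fun _ : ULift.{u} ℕ => ℝ) ∞ :=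
    { toFun := fun z => ⟨fun n => g n.down z, hmem z⟩
      map_add' := fun x y => by ext n; exact map_add (g n.down) x y
      map_smul' := fun c x => by ext n; exact map_smul (g n.down) c x }
  refine ⟨J, fun z => le_antisymm
    (lp.norm_le_of_forall_le (apply_nonneg p z) fun n => hg n.down z) ?_⟩
  refine le_of_forall_pos_lt_add fun δ hδ => ?_
  obtain ⟨n, hn⟩ := hD z (δ / 2) (half_pos hδ)
  have h1 : |g n z| ≤ ‖J z‖ := lp.norm_apply_le_norm ENNReal.top_ne_zero (J z) (ULift.up n)
  have h2 : g n z = g n (z - D n) + p (D n) := by rw [map_sub, hgD]; ring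
  have h3 := neg_le_of_abs_le (hg n (z - D n))
  have h4 : p z ≤ p (z - D n) + p (D n) := by simpa using map_add_le_add p (z - D n) (D n)
  linarith [le_abs_self (g n z)]

/-! ### Extension into one separably injective space -/

/-- Extension, along an isometric linear map `J` into a separable Banach space, of operators with
values in a separably injective space. -/
theorem IsSeparablyInjective.exists_extension_of_isometric {X : Type u} [NormedAddCommGroup X]
    [NormedSpace ℝ X] [CompleteSpace X] {lam : ℝ} (hlam : 0 ≤ lam)
    (hX : IsSeparablyInjective X lam) {V Z : Type*} [AddCommGroup V] [Module ℝ V]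
    [AddCommGroup Z] [Module ℝ Z] {B : Type u} [NormedAddCommGroup B] [NormedSpace ℝ B]
    [CompleteSpace B] [TopologicalSpace.SeparableSpace B] {p : Seminorm ℝ Z} (J : Z →ₗ[ℝ] B)
    (hJ : ∀ z, ‖J z‖ = p z) (j : V →ₗ[ℝ] Z) (t : V →ₗ[ℝ] X) (h : ∀ v, ‖t v‖ ≤ p (j v)) :
    ∃ T : Z →ₗ[ℝ] X, (∀ v, T (j v) = t v) ∧ ∀ z, ‖T z‖ ≤ lam * p z := by
  let W : Submodule ℝ B := (LinearMap.range (J ∘ₗ j)).topologicalClosure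
  have hWmem (v : V) : (J ∘ₗ j) v ∈ W :=
    Submodule.le_topologicalClosure _ (LinearMap.mem_range_self _ v)
  let e : V →ₗ[ℝ] W := (J ∘ₗ j).codRestrict W hWmem
  -- `e` need not be injective; the bound `hte` makes `t` factor through its range, and density
  -- carries it to `W`.
  have he : DenseRange e := by
    intro x
    rw [Metric.mem_closure_iff]
    intro δ hδ
    obtain ⟨_, ⟨v, rfl⟩, hv⟩ := Metric.mem_closure_iff.1 x.2 δ hδ
    exact ⟨_, ⟨v, rfl⟩, hv⟩
  have hte (v : V) : ‖t v‖ ≤ 1 * ‖e v‖ := by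
    rw [one_mul]
    exact (h v).trans_eq (hJ (j v)).symm
  obtain ⟨T, hT, hTn⟩ := hX B W (Submodule.isClosed_topologicalClosure _) (t.extendOfNorm e)
  refine ⟨T.toLinearMap ∘ₗ J, fun v => ?_, fun z => ?_⟩
  · have := hT (e v)
    rw [LinearMap.extendOfNorm_eq he ⟨1, hte⟩] at this
    exact this
  · have h1 := LinearMap.opNorm_extendOfNorm_le he zero_le_one hte
    have h2 : ‖T‖ ≤ lam := hTn.trans (mul_le_of_le_one_right hlam h1)
    have h3 := T.le_of_opNorm_le h2 (J z)
    rwa [hJ] at h3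

/-- Extension of operators dominated by a separable seminorm, with values in a separably injective
space. -/
theorem IsSeparablyInjective.exists_extension {X : Type u} [NormedAddCommGroup X]
    [NormedSpace ℝ X] [CompleteSpace X] {lam : ℝ} (hlam : 0 ≤ lam)
    (hX : IsSeparablyInjective X lam) {V Z : Type*} [AddCommGroup V] [Module ℝ V]
    [AddCommGroup Z] [Module ℝ Z] {p : Seminorm ℝ Z} (hp : p.IsSeparable) (j : V →ₗ[ℝ] Z)
    (t : V →ₗ[ℝ] X) (h : ∀ v, ‖t v‖ ≤ p (j v)) :
    ∃ T : Z →ₗ[ℝ] X, (∀ v, T (j v) = t v) ∧ ∀ z, ‖T z‖ ≤ lam * p z := by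
  obtain ⟨J, hJ⟩ := Seminorm.IsSeparable.exists_isometric_embedding.{u} hp
  obtain ⟨D, hD⟩ := hp
  let B : Submodule ℝ (lp (fun _ : ULift.{u} ℕ => ℝ) ∞) := (LinearMap.range J).topologicalClosure
  have : CompleteSpace B := (Submodule.isClosed_topologicalClosure _).completeSpace_coe
  have hmem (z : Z) : J z ∈ B := Submodule.le_topologicalClosure _ (LinearMap.mem_range_self J z)
  have : TopologicalSpace.SeparableSpace B := by
    refine ⟨Set.range fun n => J.codRestrict B hmem (D n), Set.countable_range _, fun x => ?_⟩
    rw [Metric.mem_closure_iff]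
    intro δ hδ
    obtain ⟨_, ⟨z, rfl⟩, hz⟩ := Metric.mem_closure_iff.1 x.2 (δ / 2) (half_pos hδ)
    obtain ⟨n, hn⟩ := hD z (δ / 2) (half_pos hδ)
    refine ⟨_, ⟨n, rfl⟩, ?_⟩
    have h1 : dist (J z) (J (D n)) < δ / 2 := by rwa [dist_eq_norm, ← map_sub, hJ]
    exact (dist_triangle (x : lp (fun _ : ULift.{u} ℕ => ℝ) ∞) (J z) (J (D n))).trans_lt
      (by linarith)
  exact hX.exists_extension_of_isometric hlam (J.codRestrict B hmem) hJ j t h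

/-! ### Linear comparison for `ε`-isometries -/

/-- If the norm is differentiable at `v`, then `‖r • v + x‖ - r ‖v‖` tends, as `r → ∞`, to the
derivative of the norm at `v` applied to `x`. -/
theorem tendsto_norm_smul_add_sub {F : Type*} [NormedAddCommGroup F] [NormedSpace ℝ F] {v : F}
    (hv : DifferentiableAt ℝ (fun z : F => ‖z‖) v) (x : F) :
    Tendsto (fun r : ℝ => ‖r • v + x‖ - r * ‖v‖) atTop (𝓝 (fderiv ℝ (fun z : F => ‖z‖) v x)) := by
  have h1 := (hv.hasFDerivAt.hasLineDerivAt x).tendsto_slope_zero_right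
  have h2 := h1.comp tendsto_inv_atTop_nhdsGT_zero
  refine h2.congr' ?_
  filter_upwards [eventually_gt_atTop 0] with r hr
  have h3 : r • v + x = r • (v + r⁻¹ • x) := by rw [smul_add, smul_inv_smul₀ hr.ne']
  simp only [Function.comp, inv_inv, smul_eq_mul]
  rw [h3, norm_smul, Real.norm_of_nonneg hr.le]
  ring

/-- The linear comparison between the combinations of points and of their images under a standard
`ε`-isometry, in finite dimension. -/
theorem IsStandardEpsIsometry.norm_sum_le_of_finiteDimensional {F : Type*} {Y : Type*}
    [NormedAddCommGroup F] [NormedSpace ℝ F] [FiniteDimensional ℝ F] [NormedAddCommGroup Y]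
    [NormedSpace ℝ Y] {ε : ℝ} {f : F → Y} (hf : IsStandardEpsIsometry ε f) {ι : Type*}
    (s : Finset ι) (a : ι → ℝ) (x : ι → F) :
    ‖∑ k ∈ s, a k • x k‖ ≤ ‖∑ k ∈ s, a k • f (x k)‖ + 3 * ε * ∑ k ∈ s, |a k| := by
  set u := ∑ k ∈ s, a k • x k with hu
  set S := ∑ k ∈ s, |a k| with hS
  have hS0 : 0 ≤ S := Finset.sum_nonneg fun _ _ => abs_nonneg _
  -- `δ * S` collects the errors at the points `x k`; `2 * δ` comes from replacing `u` by a nearby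
  -- `v` in both `‖u‖` and `ℓ u`.
  suffices H : ∀ δ > 0, ‖u‖ ≤ ‖∑ k ∈ s, a k • f (x k)‖ + 3 * ε * S + δ * (S + 2) by
    refine le_of_forall_pos_le_add fun δ hδ => ?_
    have := H (δ / (S + 2)) (by positivity)
    rwa [div_mul_cancel₀ _ (by positivity)] at this
  intro δ hδ
  -- Finite dimension enters here, through density of the points of differentiability of the norm.
  obtain ⟨v, hv, huv⟩ := Metric.dense_iff.1 (dense_differentiableAt_norm (E := F)) u δ hδ |>.imp
    fun v h => And.symm h
  replace huv : ‖v - u‖ < δ := by simpa [dist_eq_norm] using huv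
  set ℓ := fderiv ℝ (fun z : F => ‖z‖) v with hℓ
  have hℓ1 : ‖ℓ‖ ≤ 1 := by
    simpa using norm_fderiv_le_of_lipschitz ℝ (x₀ := v) (lipschitzWith_one_norm (E := F))
  have hℓv : ℓ v = ‖v‖ := hv.fderiv_norm_self
  have hev : ∀ᶠ r : ℝ in atTop, ∀ k ∈ s, ‖r • v + x k‖ - r * ‖v‖ ≤ ℓ (x k) + δ ∧
      ‖r • v + -x k‖ - r * ‖v‖ ≤ ℓ (-x k) + δ := by
    rw [Filter.eventually_all_finset]
    intro k _
    exact ((tendsto_norm_smul_add_sub hv (x k)).eventually_le_const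
      (lt_add_of_pos_right _ hδ)).and ((tendsto_norm_smul_add_sub hv (-x k)).eventually_le_const
      (lt_add_of_pos_right _ hδ))
  obtain ⟨r, hr, hr0⟩ := (hev.and (eventually_ge_atTop 0)).exists
  -- Since `φ` norms the difference of the images of `±r • v`, the values `φ (f (r • v))` and `-φ (f
  -- (-(r • v)))` are both at least `r * ‖v‖ - 2 * ε`.
  obtain ⟨φ, hφ1, hφ⟩ := exists_dual_vector'' ℝ (f (r • v) - f (-(r • v)))
  replace hφ : φ (f (r • v) - f (-(r • v))) = ‖f (r • v) - f (-(r • v))‖ := hφ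
  have hφle (y : Y) : φ y ≤ ‖y‖ :=
    (le_abs_self _).trans (by simpa using φ.le_of_opNorm_le hφ1 y)
  have hdist (y z : F) : ‖f y - f z‖ ≤ ‖y - z‖ + ε := by
    linarith [le_of_abs_le (hf.2 y z)]
  have hdist' (y z : F) : ‖y - z‖ - ε ≤ ‖f y - f z‖ := by
    linarith [neg_le_of_abs_le (hf.2 y z)]
  have hnorm : ‖r • v‖ = r * ‖v‖ := by rw [norm_smul, Real.norm_of_nonneg hr0]
  have h2 : 2 * (r * ‖v‖) - ε ≤ φ (f (r • v)) - φ (f (-(r • v))) := by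
    have h := hdist' (r • v) (-(r • v))
    rw [← hφ, sub_neg_eq_add, ← two_smul ℝ (r • v), norm_smul, hnorm, map_sub] at h
    simpa using h
  have h3 : φ (f (r • v)) ≤ r * ‖v‖ + ε := by
    have := hdist (r • v) 0
    rw [hf.1, sub_zero, sub_zero, hnorm] at this
    exact (hφle _).trans this
  have h4 : -φ (f (-(r • v))) ≤ r * ‖v‖ + ε := by
    have := hdist (-(r • v)) 0
    rw [hf.1, sub_zero, sub_zero, norm_neg, hnorm] at this
    rw [← map_neg]
    exact (hφle _).trans (by rwa [norm_neg])
  -- The constant 3 is this loss of `2 * ε` plus one `ε` for comparing `f (x k)` with `f (± r • v)`.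
  have h5 : ∀ k ∈ s, |ℓ (x k) - φ (f (x k))| ≤ 3 * ε + δ := by
    intro k hk
    obtain ⟨hk1, hk2⟩ := hr k hk
    have h6 := (hφle _).trans (hdist (r • v) (x k))
    have h7 := (hφle _).trans (hdist (x k) (-(r • v)))
    rw [map_sub, sub_eq_add_neg (r • v)] at h6
    rw [map_sub, sub_neg_eq_add, add_comm (x k)] at h7
    rw [map_neg] at hk2
    rw [abs_le]
    constructor <;> linarith
  have h6 : ℓ u ≤ ‖∑ k ∈ s, a k • f (x k)‖ + (3 * ε + δ) * S := by
    have h7 : ℓ u = φ (∑ k ∈ s, a k • f (x k)) + ∑ k ∈ s, a k * (ℓ (x k) - φ (f (x k))) := by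
      rw [hu, map_sum, map_sum, ← Finset.sum_add_distrib]
      refine Finset.sum_congr rfl fun k _ => ?_
      rw [map_smul, map_smul, smul_eq_mul, smul_eq_mul]
      ring
    have h8 : ∑ k ∈ s, a k * (ℓ (x k) - φ (f (x k))) ≤ (3 * ε + δ) * S := by
      rw [hS, Finset.mul_sum]
      refine Finset.sum_le_sum fun k hk => (le_abs_self _).trans ?_
      rw [abs_mul, mul_comm]
      exact mul_le_mul_of_nonneg_right (h5 k hk) (abs_nonneg _)
    rw [h7]
    exact add_le_add (hφle _) h8
  have h9 : ℓ v - ℓ u ≤ ‖v - u‖ := by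
    rw [← map_sub]
    exact (le_abs_self _).trans (by simpa using ℓ.le_of_opNorm_le hℓ1 (v - u))
  have h10 : ‖u‖ ≤ ‖v‖ + ‖v - u‖ := by
    rw [norm_sub_rev]
    simpa using norm_add_le v (u - v)
  nlinarith

/-- The linear comparison between the combinations of points and of their images under a standard
`ε`-isometry. -/
theorem IsStandardEpsIsometry.norm_sum_le {X : Type*} {Y : Type*} [NormedAddCommGroup X]
    [NormedSpace ℝ X] [NormedAddCommGroup Y] [NormedSpace ℝ Y] {ε : ℝ} {f : X → Y}
    (hf : IsStandardEpsIsometry ε f) {ι : Type*} (s : Finset ι) (a : ι → ℝ) (x : ι → X) :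
    ‖∑ k ∈ s, a k • x k‖ ≤ ‖∑ k ∈ s, a k • f (x k)‖ + 3 * ε * ∑ k ∈ s, |a k| := by
  classical
  let F := Submodule.span ℝ (s.image x : Set X)
  have hx (k : s) : x k ∈ F :=
    Submodule.subset_span (Finset.mem_coe.2 (Finset.mem_image_of_mem x k.2))
  have hF : IsStandardEpsIsometry ε fun z : F => f z := ⟨by simpa using hf.1, fun y z => hf.2 y z⟩
  have h := hF.norm_sum_le_of_finiteDimensional Finset.univ (fun k : s => a k)
    fun k => (⟨x k, hx k⟩ : F)
  rw [← Submodule.norm_coe] at h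
  simp only [Submodule.coe_sum, Submodule.coe_smul] at h
  rwa [Finset.sum_coe_sort s fun k => a k • x k, Finset.sum_coe_sort s fun k => a k • f (x k),
    Finset.sum_coe_sort s fun k => |a k|] at h

/-! ### Extension into a `c₀`-sum -/

/-- Approximation of a finite combination of a sequence whose seminorms tend to zero. -/
theorem Seminorm.linearCombination_sub_sum_le {Z : Type*} [AddCommGroup Z] [Module ℝ Z]
    (p : Seminorm ℝ Z) {y : ℕ → Z} (hy : ∀ k : ℕ, p (y k) ≤ 1 / ((k : ℝ) + 1)) (n : ℕ)
    (a : ℕ →₀ ℝ) (b : ℕ → ℝ) :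
    p (Finsupp.linearCombination ℝ y a - ∑ k ∈ Finset.range n, b k • y k) ≤
      ∑ k ∈ Finset.range n, |a k - b k| + 1 / ((n : ℝ) + 1) * l1Norm a := by
  classical
  set s := a.support \ Finset.range n with hs
  have hsub : a.support ⊆ Finset.range n ∪ s := by
    intro k hk
    by_cases hkn : k ∈ Finset.range n <;> simp_all
  have hdisj : Disjoint (Finset.range n) s := Finset.disjoint_sdiff
  have h1 : Finsupp.linearCombination ℝ y a =
      ∑ k ∈ Finset.range n, a k • y k + ∑ k ∈ s, a k • y k := by
    rw [← Finset.sum_union hdisj, Finsupp.linearCombination_apply]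
    exact Finsupp.sum_of_support_subset a hsub _ (by simp)
  have h2 : Finsupp.linearCombination ℝ y a - ∑ k ∈ Finset.range n, b k • y k =
      ∑ k ∈ Finset.range n, (a k - b k) • y k + ∑ k ∈ s, a k • y k := by
    simp only [h1, sub_smul, Finset.sum_sub_distrib]
    abel
  have h3 : p (∑ k ∈ Finset.range n, (a k - b k) • y k) ≤ ∑ k ∈ Finset.range n, |a k - b k| := by
    refine (Finset.le_sum_of_subadditive p (map_zero p).le (map_add_le_add p) _ _).trans (Finset.sum_le_sum fun k _ => ?_)
    rw [map_smul_eq_mul, Real.norm_eq_abs]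
    refine mul_le_of_le_one_right (abs_nonneg _) ((hy k).trans ?_)
    rw [div_le_one (by positivity)]
    linarith [(Nat.cast_nonneg k : (0 : ℝ) ≤ k)]
  have h4 : p (∑ k ∈ s, a k • y k) ≤ 1 / ((n : ℝ) + 1) * l1Norm a := by
    have h5 : ∑ k ∈ s, |a k| ≤ l1Norm a := by
      rw [l1Norm_eq_sum hsub]
      exact Finset.sum_le_sum_of_subset_of_nonneg Finset.subset_union_right
        fun _ _ _ => abs_nonneg _
    refine le_trans ?_ (mul_le_mul_of_nonneg_left h5 (by positivity))
    rw [Finset.mul_sum]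
    refine (Finset.le_sum_of_subadditive p (map_zero p).le (map_add_le_add p) _ _).trans (Finset.sum_le_sum fun k hk => ?_)
    rw [map_smul_eq_mul, Real.norm_eq_abs, mul_comm]
    refine mul_le_mul_of_nonneg_right ((hy k).trans ?_) (abs_nonneg _)
    have hnk : n ≤ k := by simpa using (Finset.mem_sdiff.1 hk).2
    exact one_div_le_one_div_of_le (by positivity) (by exact_mod_cast Nat.succ_le_succ hnk)
  rw [h2]
  exact (map_add_le_add p _ _).trans (add_le_add h3 h4)

section C0

variable {Λ : Type u} {E : Λ → Type v} [∀ i, NormedAddCommGroup (E i)] [∀ i, NormedSpace ℝ (E i)]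
  {V Z : Type*} [AddCommGroup V] [Module ℝ V] [AddCommGroup Z] [Module ℝ Z]

/-- For operators `t i` on a subspace tending pointwise to zero, the norm of `t i v` is uniformly
controlled, up to a small error, by the distances of `v` to the points of a compact set. -/
theorem eventually_norm_le_two_mul_add {p : Seminorm ℝ Z} {j : V →ₗ[ℝ] Z}
    {t : ∀ i, V →ₗ[ℝ] E i} (ht : ∀ i v, ‖t i v‖ ≤ p (j v))
    (ht0 : ∀ v, Tendsto (fun i => ‖t i v‖) cofinite (𝓝 0)) {y : ℕ → Z}
    (hy : ∀ k : ℕ, p (y k) ≤ 1 / ((k : ℝ) + 1)) {δ : ℝ} (hδ : 0 < δ) :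
    ∀ᶠ i in cofinite, ∀ a : ℕ →₀ ℝ, l1Norm a ≤ 1 → ∀ v,
      ‖t i v‖ ≤ 2 * p (j v + Finsupp.linearCombination ℝ y a) + δ := by
  -- Coefficients live in a cube compact for the product topology; finitely many coordinates suffice
  -- because `p (y k) → 0`.
  have hK : IsCompact (Set.univ.pi fun _ : ℕ => Set.Icc (-1 : ℝ) 1) :=
    isCompact_univ_pi fun _ => isCompact_Icc
  suffices H : ∀ᶠ i in cofinite, ∀ a : ℕ →₀ ℝ,
      (a : ℕ → ℝ) ∈ (Set.univ.pi fun _ : ℕ => Set.Icc (-1 : ℝ) 1) → l1Norm a ≤ 1 → ∀ v,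
      ‖t i v‖ ≤ 2 * p (j v + Finsupp.linearCombination ℝ y a) + δ by
    filter_upwards [H] with i hi a ha
    exact hi a (fun k _ => abs_le.1 ((abs_apply_le_l1Norm a k).trans ha)) ha
  refine hK.induction_on (p := fun S : Set (ℕ → ℝ) => ∀ᶠ i in cofinite, ∀ a : ℕ →₀ ℝ,
      (a : ℕ → ℝ) ∈ S → l1Norm a ≤ 1 → ∀ v,
      ‖t i v‖ ≤ 2 * p (j v + Finsupp.linearCombination ℝ y a) + δ) (by simp) ?_ ?_ ?_
  · intro S S' hSS' hS'
    filter_upwards [hS'] with i hi a ha using hi a (hSS' ha)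
  · intro S S' hS hS'
    filter_upwards [hS, hS'] with i hi hi' a ha
    exact ha.elim (hi a) (hi' a)
  intro b _
  obtain ⟨n, hn⟩ := exists_nat_one_div_lt (show 0 < δ / 16 by positivity)
  set g := ∑ k ∈ Finset.range n, b k • y k with hg
  have hbdd : BddBelow (Set.range fun v => p (j v + g)) :=
    ⟨0, by rintro _ ⟨v, rfl⟩; exact apply_nonneg p _⟩
  -- A near-minimiser `v₀` gives `p (j (v - v₀)) ≤ 2 * p (j v + g) + δ / 4`, the source of the
  -- factor 2. It depends only on `b`, so smallness of `‖t i v₀‖` serves every `a` near `b` and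
  -- every `v`.
  obtain ⟨v₀, hv₀⟩ := exists_lt_of_ciInf_lt
    (lt_add_of_pos_right (⨅ v, p (j v + g)) (show 0 < δ / 4 by positivity))
  have hv₀' (v : V) : p (j v₀ + g) ≤ p (j v + g) + δ / 4 := by
    linarith [ciInf_le hbdd v]
  refine ⟨{b' | ∑ k ∈ Finset.range n, |b' k - b k| < δ / 16}, mem_nhdsWithin_of_mem_nhds ?_, ?_⟩
  · have hc : Continuous fun b' : ℕ → ℝ => ∑ k ∈ Finset.range n, |b' k - b k| := by fun_prop
    exact hc.continuousAt.eventually_lt continuousAt_const (by simpa using by positivity)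
  filter_upwards [(ht0 v₀).eventually_le_const (show 0 < δ / 4 by positivity)] with i hi a ha ha1 v
  have h1 : p (Finsupp.linearCombination ℝ y a - g) ≤ δ / 8 := by
    refine (p.linearCombination_sub_sum_le hy n a b).trans ?_
    have h2 : 1 / ((n : ℝ) + 1) * l1Norm a ≤ δ / 16 :=
      (mul_le_of_le_one_right (by positivity) ha1).trans hn.le
    have h3 : ∑ k ∈ Finset.range n, |a k - b k| < δ / 16 := ha
    linarith
  have h2 : p (j v + g) ≤ p (j v + Finsupp.linearCombination ℝ y a) + δ / 8 := by
    have h3 := map_sub_le_add p (j v + Finsupp.linearCombination ℝ y a)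
      (Finsupp.linearCombination ℝ y a - g)
    rw [show ∀ x z w : Z, x + z - (z - w) = x + w by intros; abel] at h3
    linarith
  have h3 : ‖t i v‖ ≤ ‖t i (v - v₀)‖ + ‖t i v₀‖ := by
    simpa using norm_add_le (t i (v - v₀)) (t i v₀)
  have h4 : p (j (v - v₀)) ≤ p (j v + g) + p (j v₀ + g) := by
    have h5 := map_sub_le_add p (j v + g) (j v₀ + g)
    rwa [add_sub_add_right_eq_sub, ← map_sub] at h5
  linarith [ht i (v - v₀), hv₀' v]

/-- The best constant `η i` in `‖t i v‖ ≤ 2 p (j v + ∑ aₖ yₖ) + η i ‖a‖₁` tends to zero. -/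
theorem exists_tendsto_zero_norm_le {p : Seminorm ℝ Z} {j : V →ₗ[ℝ] Z}
    {t : ∀ i, V →ₗ[ℝ] E i} (ht : ∀ i v, ‖t i v‖ ≤ p (j v))
    (ht0 : ∀ v, Tendsto (fun i => ‖t i v‖) cofinite (𝓝 0)) {y : ℕ → Z}
    (hy : ∀ k : ℕ, p (y k) ≤ 1 / ((k : ℝ) + 1)) :
    ∃ η : Λ → ℝ, (∀ i, 0 ≤ η i) ∧ Tendsto η cofinite (𝓝 0) ∧ ∀ i v (a : ℕ →₀ ℝ),
      ‖t i v‖ ≤ 2 * p (j v + Finsupp.linearCombination ℝ y a) + η i * l1Norm a := by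
  let S (i : Λ) : Set ℝ := {δ | 0 ≤ δ ∧ ∀ v (a : ℕ →₀ ℝ),
    ‖t i v‖ ≤ 2 * p (j v + Finsupp.linearCombination ℝ y a) + δ * l1Norm a}
  have hone (i : Λ) : (1 : ℝ) ∈ S i := by
    refine ⟨zero_le_one, fun v a => ?_⟩
    -- Truncation at `n = 0` gives `p (∑ aₖ yₖ) ≤ ‖a‖₁`.
    have h1 := p.linearCombination_sub_sum_le hy 0 a 0
    simp only [Finset.range_zero, Finset.sum_empty, sub_zero, Nat.cast_zero, zero_add, div_one]
      at h1
    have h2 := map_sub_le_add p (j v + Finsupp.linearCombination ℝ y a)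
      (Finsupp.linearCombination ℝ y a)
    rw [add_sub_cancel_right] at h2
    linarith [ht i v, apply_nonneg p (j v + Finsupp.linearCombination ℝ y a)]
  have hbdd (i : Λ) : BddBelow (S i) := ⟨0, fun δ hδ => hδ.1⟩
  have hη (i : Λ) : 0 ≤ sInf (S i) := le_csInf ⟨1, hone i⟩ fun δ hδ => hδ.1
  refine ⟨fun i => sInf (S i), hη, ?_, fun i v a => ?_⟩
  · rw [Metric.tendsto_nhds]
    intro δ hδ
    filter_upwards [eventually_norm_le_two_mul_add ht ht0 hy (half_pos hδ)] with i hi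
    have hmem : δ / 2 ∈ S i := by
      refine ⟨(half_pos hδ).le, fun v a => ?_⟩
      rcases (l1Norm_nonneg a).eq_or_lt' with h0 | h0
      · rw [eq_zero_of_l1Norm_eq_zero h0]
        have := ht i v
        simp only [map_zero, add_zero, l1Norm_zero, mul_zero]
        linarith [apply_nonneg p (j v)]
      -- Both sides are homogeneous in `(v, a)`, so normalise to `‖a‖₁ = 1`.
      · set c := l1Norm a with hc
        have h1 := hi (c⁻¹ • a) (by rw [l1Norm_smul, abs_of_pos (inv_pos.2 h0), ← hc,
          inv_mul_cancel₀ h0.ne']) (c⁻¹ • v)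
        rw [map_smul, map_smul, map_smul, ← smul_add, map_smul_eq_mul, norm_smul,
          Real.norm_of_nonneg (inv_pos.2 h0).le] at h1
        have h2 := mul_le_mul_of_nonneg_left h1 h0.le
        rw [mul_inv_cancel_left₀ h0.ne', mul_add, mul_left_comm, mul_inv_cancel_left₀ h0.ne'] at h2
        linarith
    rw [Real.dist_eq, sub_zero, abs_of_nonneg (hη i)]
    linarith [csInf_le (hbdd i) hmem]
  · rcases (l1Norm_nonneg a).eq_or_lt' with h0 | h0
    · have := (hone i).2 v a
      rw [h0] at this ⊢
      linarith
    · have h1 : (‖t i v‖ - 2 * p (j v + Finsupp.linearCombination ℝ y a)) / l1Norm a ≤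
          sInf (S i) := by
        refine le_csInf ⟨1, hone i⟩ fun δ hδ => ?_
        rw [div_le_iff₀ h0]
        linarith [hδ.2 v a]
      rw [div_le_iff₀ h0] at h1
      linarith

end C0

/-- Extension of operators dominated by a separable seminorm, with values in the `c₀`-sum of
separably injective spaces. -/
theorem exists_extension_c0Sum {Λ : Type u} {E : Λ → Type v} [∀ i, NormedAddCommGroup (E i)]
    [∀ i, NormedSpace ℝ (E i)] [∀ i, CompleteSpace (E i)] {lam : ℝ} (hlam : 0 ≤ lam)
    (hE : ∀ i, IsSeparablyInjective (E i) lam) {V Z : Type*} [AddCommGroup V] [Module ℝ V]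
    [AddCommGroup Z] [Module ℝ Z] {p : Seminorm ℝ Z} (hp : p.IsSeparable) (j : V →ₗ[ℝ] Z)
    (t : V →ₗ[ℝ] c0Sum E) (h : ∀ v, ‖t v‖ ≤ p (j v)) :
    ∃ T : Z →ₗ[ℝ] c0Sum E, (∀ v, T (j v) = t v) ∧ ∀ z, ‖T z‖ ≤ 2 * lam * p z := by
  obtain ⟨D, hD⟩ := id hp
  -- Rescaling makes the dense sequence tend to zero in `p` without changing its span.
  let c (k : ℕ) : ℝ := (((k : ℝ) + 1) * (1 + p (D k)))⁻¹
  have hpD (k : ℕ) : 0 < 1 + p (D k) := by linarith [apply_nonneg p (D k)]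
  have hc (k : ℕ) : 0 < c k := inv_pos.2 (mul_pos (by positivity) (hpD k))
  let y (k : ℕ) : Z := c k • D k
  have hy (k : ℕ) : p (y k) ≤ 1 / ((k : ℝ) + 1) := by
    have h1 : p (y k) = 1 / ((k : ℝ) + 1) * (p (D k) / (1 + p (D k))) := by
      rw [map_smul_eq_mul, Real.norm_of_nonneg (hc k).le,
        show c k = (((k : ℝ) + 1) * (1 + p (D k)))⁻¹ from rfl, mul_inv]
      ring
    rw [h1]
    refine mul_le_of_le_one_right (by positivity) ?_
    rw [div_le_one (hpD k)]
    linarith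
  let t' (i : Λ) : V →ₗ[ℝ] E i :=
    { toFun := fun v => (t v : lp E ∞) i
      map_add' := fun v w => by rw [map_add]; rfl
      map_smul' := fun r v => by rw [map_smul]; rfl }
  have ht' (i : Λ) (v : V) : ‖t' i v‖ ≤ p (j v) :=
    (lp.norm_apply_le_norm ENNReal.top_ne_zero (t v : lp E ∞) i).trans (h v)
  obtain ⟨η, hη, hη0, hηt⟩ := exists_tendsto_zero_norm_le ht' (fun v => (t v).2) hy
  have hext (i : Λ) : ∃ T : Z →ₗ[ℝ] E i, (∀ v, T (j v) = t' i v) ∧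
      (∀ z, ‖T z‖ ≤ 2 * lam * p z) ∧ ∀ k, ‖T (y k)‖ ≤ lam * η i := by
    let q : Seminorm ℝ Z := p + p
    have hq (z : Z) : q z = 2 * p z := (two_mul (p z)).symm
    have hqsep : q.IsSeparable := ⟨D, fun z δ hδ => by
      obtain ⟨n, hn⟩ := hD z (δ / 2) (half_pos hδ)
      exact ⟨n, by rw [hq]; linarith⟩⟩
    let j₂ : V × (ℕ →₀ ℝ) →ₗ[ℝ] Z × (ℕ →₀ ℝ) :=
      (j.coprod (Finsupp.linearCombination ℝ y)).prod (LinearMap.snd ℝ V (ℕ →₀ ℝ))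
    obtain ⟨T, hT, hTn⟩ := (hE i).exists_extension hlam (hqsep.prodL1 (η i) (hη i)) j₂
      (t' i ∘ₗ LinearMap.fst ℝ V (ℕ →₀ ℝ)) (fun x => by
        rw [Seminorm.prodL1_apply, hq]
        exact hηt i x.1 x.2)
    refine ⟨T ∘ₗ LinearMap.inl ℝ Z (ℕ →₀ ℝ), fun v => ?_, fun z => ?_, fun k => ?_⟩
    · have := hT (v, 0)
      simpa [j₂] using this
    · have := hTn (z, 0)
      rw [Seminorm.prodL1_apply, hq, l1Norm_zero, mul_zero, add_zero] at this
      simp only [LinearMap.comp_apply, LinearMap.inl_apply]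
      linarith
    -- The extension vanishes at `j₂ (0, eₖ) = (yₖ, eₖ)`, so its value at `(yₖ, 0)` is minus that at
    -- `(0, eₖ)`, a vector of seminorm `η i`.
    · have h1 := hT (0, Finsupp.single k 1)
      have h2 : j₂ (0, Finsupp.single k 1) = (y k, 0) + (0, Finsupp.single k 1) := by
        simp [j₂]
      rw [h2, map_add, LinearMap.comp_apply, LinearMap.fst_apply, map_zero,
        add_eq_zero_iff_eq_neg] at h1
      have h3 := hTn (0, Finsupp.single k 1)
      rw [Seminorm.prodL1_apply, map_zero, l1Norm_single, abs_one, mul_one, zero_add] at h3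
      rwa [LinearMap.comp_apply, LinearMap.inl_apply, h1, norm_neg]
  choose T hTj hTn hTy using hext
  have hmem (z : Z) : Memℓp (fun i => T i z) ∞ :=
    memℓp_infty ⟨2 * lam * p z, by rintro _ ⟨i, rfl⟩; exact hTn i z⟩
  have hzero (z : Z) : Tendsto (fun i => ‖T i z‖) cofinite (𝓝 0) := by
    rw [Metric.tendsto_nhds]
    intro δ hδ
    obtain ⟨k, hk⟩ := hD z (δ / 2 / (2 * lam + 1)) (by positivity)
    rw [lt_div_iff₀ (by positivity)] at hk
    have h1 : Tendsto (fun i => (c k)⁻¹ * (lam * η i)) cofinite (𝓝 0) := by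
      simpa using (hη0.const_mul lam).const_mul (c k)⁻¹
    filter_upwards [h1.eventually_lt_const (half_pos hδ)] with i hi
    rw [dist_zero_right, norm_norm]
    have h2 : T i z = T i (z - D k) + (c k)⁻¹ • T i (y k) := by
      rw [← map_smul, ← map_add, inv_smul_smul₀ (hc k).ne', sub_add_cancel]
    have h3 : ‖(c k)⁻¹ • T i (y k)‖ ≤ (c k)⁻¹ * (lam * η i) := by
      rw [norm_smul, Real.norm_of_nonneg (inv_pos.2 (hc k)).le]
      exact mul_le_mul_of_nonneg_left (hTy i k) (inv_pos.2 (hc k)).le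
    have h4 := norm_add_le (T i (z - D k)) ((c k)⁻¹ • T i (y k))
    rw [← h2] at h4
    linarith [hTn i (z - D k), apply_nonneg p (z - D k)]
  refine ⟨{ toFun := fun z => ⟨⟨fun i => T i z, hmem z⟩, hzero z⟩
            map_add' := fun z w => ?_
            map_smul' := fun r z => ?_ }, fun v => ?_, fun z => ?_⟩
  · ext i; exact map_add (T i) z w
  · ext i; exact map_smul (T i) r z
  · ext i; exact hTj i v
  · exact lp.norm_le_of_forall_le (mul_nonneg (by positivity) (apply_nonneg p z))
      fun i => hTn i z

/-! ### Stability -/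

/-- For a map `f` into a separable space, some sequence has an image dense in the range of `f`. -/
theorem exists_seq_forall_norm_sub_lt {X Y : Type*} [Nonempty X] [NormedAddCommGroup Y]
    [TopologicalSpace.SeparableSpace Y] (f : X → Y) :
    ∃ d : ℕ → X, ∀ x, ∀ δ > 0, ∃ n, ‖f x - f (d n)‖ < δ := by
  have : SecondCountableTopology Y := UniformSpace.secondCountable_of_separable Y
  have : Nonempty (Set.range f) := (Set.range_nonempty f).to_subtype
  obtain ⟨e, he⟩ := TopologicalSpace.exists_dense_seq (Set.range f)
  choose d hd using fun n => (e n).2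
  refine ⟨d, fun x δ hδ => ?_⟩
  obtain ⟨_, ⟨n, rfl⟩, hn⟩ := Metric.mem_closure_iff.1 (he ⟨f x, x, rfl⟩) δ hδ
  refine ⟨n, ?_⟩
  rw [hd, ← dist_eq_norm]
  exact hn

/-- Standard `ε`-isometries from a `c₀`-sum of `lam`-separably injective spaces to a separable
space are `(2 lam, 8 lam)`-stable. -/
theorem isStableMap_c0Sum {Λ : Type u} (E : Λ → Type v) [∀ i, NormedAddCommGroup (E i)]
    [∀ i, NormedSpace ℝ (E i)] [∀ i, CompleteSpace (E i)] {lam : ℝ} (hlam : 1 ≤ lam)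
    (hE : ∀ i, IsSeparablyInjective (E i) lam) {Y : Type*} [NormedAddCommGroup Y]
    [NormedSpace ℝ Y] [TopologicalSpace.SeparableSpace Y] {ε : ℝ} (hε : 0 ≤ ε) {f : c0Sum E → Y}
    (hf : IsStandardEpsIsometry ε f) : IsStableMap (2 * lam) (8 * lam) ε f := by
  obtain ⟨d, hd⟩ := exists_seq_forall_norm_sub_lt f
  have hp : (normSeminorm ℝ Y).IsSeparable := by
    obtain ⟨e, he⟩ := exists_seq_forall_norm_sub_lt (id : Y → Y)
    exact ⟨e, he⟩
  have h3ε : 0 ≤ 3 * ε := by positivity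
  obtain ⟨T, hT, hTn⟩ := exists_extension_c0Sum (by linarith) hE (hp.prodL1 (3 * ε) h3ε)
    ((Finsupp.linearCombination ℝ fun k => f (d k)).prod LinearMap.id)
    (Finsupp.linearCombination ℝ d) (fun a => by
      rw [Seminorm.prodL1_apply]
      exact hf.norm_sum_le a.support a d)
  have hTY (y : Y) : ‖T (y, 0)‖ ≤ 2 * lam * ‖y‖ := by
    have := hTn (y, 0)
    rwa [Seminorm.prodL1_apply, l1Norm_zero, mul_zero, add_zero] at this
  have hTd (k : ℕ) : ‖T (f (d k), 0) - d k‖ ≤ 2 * lam * (3 * ε) := by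
    have h1 : T (f (d k), Finsupp.single k 1) = d k := by
      simpa [Function.prod] using hT (Finsupp.single k 1)
    have h2 : (f (d k), Finsupp.single k (1 : ℝ)) = (f (d k), 0) + (0, Finsupp.single k 1) := by
      simp
    rw [h2, map_add] at h1
    have h3 := hTn (0, Finsupp.single k 1)
    rw [Seminorm.prodL1_apply, map_zero, l1Norm_single, abs_one, mul_one, zero_add] at h3
    rwa [eq_sub_of_add_eq h1, sub_sub_cancel_left, norm_neg]
  let T' : Y →ₗ[ℝ] c0Sum E := T ∘ₗ LinearMap.inl ℝ Y (ℕ →₀ ℝ)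
  refine ⟨(T' ∘ₗ (closedSpanRange f).subtype).mkContinuous (2 * lam) fun y => hTY y,
    LinearMap.mkContinuous_norm_le _ (by linarith) _, fun x => ?_⟩
  change ‖T (f x, 0) - x‖ ≤ 8 * lam * ε
  refine le_of_forall_pos_le_add fun δ hδ => ?_
  obtain ⟨n, hn⟩ := hd x (δ / (2 * lam + 1)) (by positivity)
  rw [lt_div_iff₀ (by positivity)] at hn
  have h1 : T (f x, 0) - x = T (f x - f (d n), 0) + (T (f (d n), 0) - d n) + (d n - x) := by
    have h2 : (f x, (0 : ℕ →₀ ℝ)) = (f x - f (d n), 0) + (f (d n), 0) := by simp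
    rw [h2, map_add]
    abel
  have h3 := neg_le_of_abs_le (hf.2 x (d n))
  rw [norm_sub_rev x] at h3
  have h4 := norm_add₃_le (a := T (f x - f (d n), 0)) (b := T (f (d n), 0) - d n) (c := d n - x)
  rw [← h1] at h4
  have h5 : ε ≤ lam * ε := le_mul_of_one_le_left hε hlam
  -- The error is `6λε` at `d n` plus `ε` from `‖d n - x‖ ≤ ‖f x - f (d n)‖ + ε`, at most `7λε`;
  -- terms in `‖f x - f (d n)‖` are absorbed by `δ`.
  linarith [hTY (f x - f (d n)), hTd n]

/-- Stability with given constants implies stability with larger constants. -/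
theorem IsStableMap.mono {X : Type*} {Y : Type*} [NormedAddCommGroup X] [NormedSpace ℝ X]
    [NormedAddCommGroup Y] [NormedSpace ℝ Y] {α α' γ γ' ε : ℝ} {f : X → Y} (hε : 0 ≤ ε)
    (hα : α ≤ α') (hγ : γ ≤ γ') (h : IsStableMap α γ ε f) : IsStableMap α' γ' ε f := by
  obtain ⟨T, hT, hTf⟩ := h
  exact ⟨T, hT.trans hα, fun x => (hTf x).trans (mul_le_mul_of_nonneg_right hγ hε)⟩

theorem corollary4p5 {Λ : Type u} (E : Λ → Type u) [∀ i, NormedAddCommGroup (E i)]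
    [∀ i, NormedSpace ℝ (E i)] [∀ i, CompleteSpace (E i)] (lam : ℝ) (hlam : 1 ≤ lam)
    (hE : ∀ i, IsSeparablyInjective (E i) lam)
    (Y : Type v) [NormedAddCommGroup Y] [NormedSpace ℝ Y] [CompleteSpace Y]
    [TopologicalSpace.SeparableSpace Y] :
    IsStablePair (c0Sum E) Y (6 * lam ^ 2) (24 * lam ^ 2) ∧
    (∀ α γ : ℝ, 3 * lam * (1 + lam) < α → 12 * lam * (1 + lam) < γ →
      IsStablePair (c0Sum E) Y α γ) ∧
    (∀ α γ : ℝ, 9 * lam ^ 2 < α → 36 * lam ^ 2 < γ → IsStablePair (c0Sum E) Y α γ) ∧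
    IsStablePair (c0Sum E) Y (18 * (1 + lam)) (72 * (1 + lam)) := by
  -- As `λ ≥ 1`, every pair of constants claimed dominates `(2λ, 8λ)`.
  have key (α γ : ℝ) (hα : 2 * lam ≤ α) (hγ : 8 * lam ≤ γ) : IsStablePair (c0Sum E) Y α γ :=
    ⟨by linarith, by linarith, fun ε hε f hf => (isStableMap_c0Sum E hlam hE hε hf).mono hε hα hγ⟩
  have hsq : lam ≤ lam ^ 2 := by nlinarith
  exact ⟨key _ _ (by linarith) (by linarith),
    fun α γ hα hγ => key _ _ (by linarith) (by linarith),
    fun α γ hα hγ => key _ _ (by linarith) (by linarith), key _ _ (by linarith) (by linarith)⟩
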